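/- Consider the following online problem on the segment $[-1,1]$. A request is a triple $(x,[r,r+2],\delta)$ with location $x\in[-1,1]$, release time $r\ge 0$ and weight $\delta>0$. For an integer $n\ge 2$ and a real $T$, let $\mathcal I_{n,T}$ be the set of instances consisting of at least one and at most $n$ requests such that the release times of successive requests differ by at least $T$. An itinerary is a map $p:[0,\infty)\to[-1,1]$ with $p(0)=0$ and $|p(s)-p(t)|\le|s-t|$ for all $s,t$; it serves the request $(x,[r,r+2],\delta)$ if $p(t)=x$ for some $t\in[r,r+2]$. The performance of an itinerary on an instance $I$ is the total weight of the requests it serves divided by the total weight of all requests of $I$, and $\lambda_{OPT}^I$ is the supremum of the performances on $I$ of all itineraries. An online algorithm $ALG$ assigns to every finite instance $I$ an itinerary whose restriction to $[0,t]$ depends, for every $t\ge 0$, only on the requests of $I$ released at times $\le t$; the performance of this itinerary on $I$ is denoted $\lambda_{ALG}^I$. The optimal performance and the optimal competitive ratio are $$\lambda^{\mathcal I_{n,T}}=\sup_{ALG}\ \inf_{I\in\mathcal I_{n,T}}\lambda_{ALG}^I,\qquad \gamma^{\mathcal I_{n,T}}=\sup_{ALG}\ \inf_{I\in\mathcal I_{n,T}}\frac{\lambda_{ALG}^I}{\lambda_{OPT}^I}.$$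 For $m\ge 1$ let $$\alpha_m=\inf_{\delta\in(0,\infty)^m}\max\Big\{\frac{\delta_1}{S_2},\dots,\frac{\delta_{m-1}}{S_m},\frac{\delta_m}{S_m}\Big\},\qquad S_i=\sum_{k=1}^i\delta_k .$$ Theorem. Let $n\ge 2$. If $1\le T\le 2-\frac1{n-1}$, then $$\lambda^{\mathcal I_{n,T}}=\gamma^{\mathcal I_{n,T}}=\alpha_{n-\lfloor 1/(2-T)\rfloor}.$$ If $T\ge 2-\frac1{n-1}$, then $\lambda^{\mathcal I_{n,T}}=\gamma^{\mathcal I_{n,T}}=1$. -/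

import Mathlib

noncomputable section

namespace OPTiWinD

/-- A request on the segment `[-1, 1]`: a location, a release time and a positive weight.
Its time window is `[release, release + 2]`. -/
structure Request where
  loc : ℝ
  release : ℝ
  weight : ℝ
  loc_mem : loc ∈ Set.Icc (-1 : ℝ) 1
  release_nonneg : 0 ≤ release
  weight_pos : 0 < weight

/-- An instance: a finite collection of requests, listed in order of release. -/
structure Instance where
  requests : List Request
  sorted : requests.Pairwise (fun f g => f.release ≤ g.release)

/-- An itinerary of the vehicle: it starts at the origin at time `0`, stays in `[-1, 1]` and
moves with speed at most one. Only the values of `pos` at times `t ≥ 0` are meaningful. -/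
structure Itinerary where
  pos : ℝ → ℝ
  pos_zero : pos 0 = 0
  pos_mem : ∀ t, 0 ≤ t → pos t ∈ Set.Icc (-1 : ℝ) 1
  speed_le : ∀ s t, 0 ≤ s → 0 ≤ t → |pos s - pos t| ≤ |s - t|

/-- The request is visited during its time window. -/
def Itinerary.Serves (p : Itinerary) (f : Request) : Prop :=
  ∃ t ∈ Set.Icc f.release (f.release + 2), p.pos t = f.loc

/-- Total weight of the requests of an instance. -/
def Instance.totalWeight (I : Instance) : ℝ :=
  (I.requests.map Request.weight).sum

open scoped Classical in
/-- Total weight of the requests served by an itinerary. -/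
def Itinerary.servedWeight (p : Itinerary) (I : Instance) : ℝ :=
  ((I.requests.filter (fun f => p.Serves f)).map Request.weight).sum

/-- The fraction of the total weight that is served. -/
def Itinerary.performance (p : Itinerary) (I : Instance) : ℝ :=
  p.servedWeight I / I.totalWeight

open scoped Classical in
/-- The requests released up to and including time `t`. -/
def Instance.revealed (I : Instance) (t : ℝ) : List Request :=
  I.requests.filter (fun f => f.release ≤ t)

/-- A (deterministic) online algorithm: it produces an itinerary for every instance, and the
motion up to time `t` depends only on the requests released up to time `t`. In particular the
algorithm does not know how many requests are still to come. -/
structure OnlineAlgorithm where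
  run : Instance → Itinerary
  causal : ∀ (I J : Instance) (t : ℝ), 0 ≤ t → I.revealed t = J.revealed t →
    ∀ s ∈ Set.Icc (0 : ℝ) t, (run I).pos s = (run J).pos s

/-- The instances with at least one and at most `n` requests and with delay at least `T` between
the release times of requests. (Without requests the performance would be `0 / 0`.) -/
def instanceClass (n : ℕ) (T : ℝ) : Set Instance :=
  {I | I.requests ≠ [] ∧ I.requests.length ≤ n ∧
    I.requests.Pairwise (fun f g => f.release + T ≤ g.release)}

/-- The performance of an optimal offline solution, which knows the whole instance. -/
def optPerformance (I : Instance) : ℝ :=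
  ⨆ p : Itinerary, p.performance I

/-- The performance of an online algorithm on the class of instances. -/
def OnlineAlgorithm.classPerformance (A : OnlineAlgorithm) (n : ℕ) (T : ℝ) : ℝ :=
  ⨅ I : instanceClass n T, (A.run I).performance I

/-- The competitive ratio of an online algorithm on the class of instances. -/
def OnlineAlgorithm.competitiveRatio (A : OnlineAlgorithm) (n : ℕ) (T : ℝ) : ℝ :=
  ⨅ I : instanceClass n T, (A.run I).performance I / optPerformance I

/-- The optimal performance over all online algorithms. -/
def optimalPerformance (n : ℕ) (T : ℝ) : ℝ :=
  ⨆ A : OnlineAlgorithm, A.classPerformance n T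

/-- The optimal competitive ratio over all online algorithms. -/
def optimalCompetitiveRatio (n : ℕ) (T : ℝ) : ℝ :=
  ⨆ A : OnlineAlgorithm, A.competitiveRatio n T

/-- `alpha m` is the infimum over positive vectors of
`max {δ₁ / S₂, …, δₘ₋₁ / Sₘ, δₘ / Sₘ}`, `Sᵢ = δ₁ + ⋯ + δᵢ`, for `m ≥ 1`. Indices start at `0`
here: the sum over `k ≤ i + 1` is the partial sum that includes the next entry, and for the last
index it is the full sum. -/
def alpha (m : ℕ) : ℝ :=
  ⨅ δ : {δ : Fin m → ℝ // ∀ i, 0 < δ i},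
    ⨆ i : Fin m, δ.1 i / ∑ k : Fin m with k.val ≤ i.val + 1, δ.1 k

end OPTiWinD

end

/-!
Write `u = 2 - T` and `q = ⌊1 / u⌋`. Since optimal performances are at most one, the optimal
performance is at most the optimal competitive ratio, so it remains to bound the former from below
and the latter from above by `alpha (n - q)`.

*An algorithm.* While at most `q` requests are released, the vehicle goes straight to the newest
request and then back towards the origin. A new request finds it at distance at most `k * u` from
the origin, where `k` is the number of earlier requests, so all of them are served in time
(`allServed_append`). From then on a request `g` is pursued, and when the next one appears, the
vehicle either stays with `g` and skips the new request, if this secures the fraction `c` of the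
weight released so far, or skips `g` and turns to the new request; the length `2` of the windows
makes every new request reachable. If neither option secured the fraction `c`, then the requests
that were pursued since the last time a request was served would have all the ratios in the
definition of `alpha` below `c`, which is impossible for `c = alpha (n - q)`, as there are at most
`n - q` of them (`rests_or_pursues_of_pursues`).

*An adversary.* Let `c > alpha (n - q)` and suppose that an algorithm always serves more than `c`
times the weight that any itinerary serves. The adversary presents requests at alternating ends of
the segment. The first `q + 1` requests have such fast growing weights that each has to be served,
and the distance of the vehicle from the newest request grows by `u` each time, until it exceeds
`T` (`OnlineAlgorithm.Beats.first_phase`). From then on the next request can be released immediately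
before the vehicle serves the current one. The two are incompatible, and the distance from the new
request is almost `2`, so this can be repeated. With weights that nearly attain `alpha (n - q)` the
algorithm has to skip each of these requests in favour of the next one, and it ends up with the last
one only (`OnlineAlgorithm.Beats.second_phase`). As these requests are released almost `2` time
units apart, an itinerary that shuttles between the ends serves all of them, so that the bound
holds for the competitive ratio as well.

If `T ≥ 2 - 1 / (n - 1)`, the algorithm works with `q = n - 1`, and `alpha 1 = 1`.
-/

namespace OPTiWinD

/-! ### Served weight and itineraries -/

/-- The total weight of a list of requests. -/
def weightSum (L : List Request) : ℝ := (L.map Request.weight).sum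

open scoped Classical in
/-- The total weight of the requests of a list that are served by an itinerary. -/
noncomputable def Itinerary.servedSum (p : Itinerary) (L : List Request) : ℝ :=
  weightSum (L.filter fun f => p.Serves f)

/-- Successive requests of the list are released with delay at least `T`. -/
def Spaced (T : ℝ) (L : List Request) : Prop :=
  L.Pairwise fun f g => f.release + T ≤ g.release

/-- The two itineraries coincide on `[0, t]`. -/
def Itinerary.AgreeUpTo (p p' : Itinerary) (t : ℝ) : Prop :=
  ∀ s ∈ Set.Icc (0 : ℝ) t, p.pos s = p'.pos s

theorem weightSum_append (L M : List Request) :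
    weightSum (L ++ M) = weightSum L + weightSum M := by
  simp [weightSum]

theorem weightSum_singleton (f : Request) : weightSum [f] = f.weight := by
  simp [weightSum]

theorem weightSum_nonneg (L : List Request) : 0 ≤ weightSum L := by
  refine List.sum_nonneg fun x hx => ?_
  obtain ⟨f, -, rfl⟩ := List.mem_map.1 hx
  exact f.weight_pos.le

theorem weightSum_pos {L : List Request} (hL : L ≠ []) : 0 < weightSum L := by
  cases L with
  | nil => exact absurd rfl hL
  | cons f L =>
    have := weightSum_append [f] L
    rw [weightSum_singleton] at this
    have h1 := weightSum_nonneg L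
    have h2 := f.weight_pos
    simp only [List.singleton_append] at this
    linarith

namespace Itinerary

variable (p p' : Itinerary)

theorem servedSum_nil : p.servedSum [] = 0 := by simp [servedSum, weightSum]

theorem servedSum_append (L M : List Request) :
    p.servedSum (L ++ M) = p.servedSum L + p.servedSum M := by
  simp [servedSum, weightSum_append]

variable {p p'}

theorem servedSum_singleton {f : Request} (h : p.Serves f) :
    p.servedSum [f] = f.weight := by
  simp [servedSum, h, weightSum]

theorem servedSum_singleton_of_not {f : Request} (h : ¬ p.Serves f) :
    p.servedSum [f] = 0 := by
  simp [servedSum, h, weightSum]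

theorem servedSum_mono {L : List Request} (h : ∀ f ∈ L, p.Serves f → p'.Serves f) :
    p.servedSum L ≤ p'.servedSum L := by
  induction L with
  | nil => simp [servedSum_nil]
  | cons f L ih =>
    have e := p.servedSum_append [f] L
    have e' := p'.servedSum_append [f] L
    simp only [List.singleton_append] at e e'
    have h1 := ih fun g hg => h g (List.mem_cons_of_mem _ hg)
    have h2 : p.servedSum [f] ≤ p'.servedSum [f] := by
      by_cases hp : p.Serves f
      · rw [servedSum_singleton hp, servedSum_singleton (h f List.mem_cons_self hp)]
      · rw [servedSum_singleton_of_not hp]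
        exact weightSum_nonneg _
    linarith

theorem servedSum_eq_weightSum {L : List Request} (h : ∀ f ∈ L, p.Serves f) :
    p.servedSum L = weightSum L := by
  rw [servedSum, List.filter_eq_self.2 (by simpa using h)]

theorem servedSum_eq_zero {L : List Request} (h : ∀ f ∈ L, ¬ p.Serves f) :
    p.servedSum L = 0 := by
  rw [servedSum, List.filter_eq_nil_iff.2 (by simpa using h)]
  simp [weightSum]

variable (p)

theorem servedSum_nonneg (L : List Request) : 0 ≤ p.servedSum L := weightSum_nonneg _

theorem servedSum_le_weightSum (L : List Request) : p.servedSum L ≤ weightSum L := by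
  induction L with
  | nil => simp [servedSum_nil, weightSum]
  | cons f L ih =>
    have e := p.servedSum_append [f] L
    have e' := weightSum_append [f] L
    simp only [List.singleton_append] at e e'
    have h2 : p.servedSum [f] ≤ weightSum [f] := by
      by_cases hp : p.Serves f
      · rw [servedSum_singleton hp, weightSum_singleton]
      · rw [servedSum_singleton_of_not hp]
        exact weightSum_nonneg _
    linarith

theorem performance_eq (I : Instance) :
    p.performance I = p.servedSum I.requests / weightSum I.requests := rfl

theorem performance_nonneg (I : Instance) : 0 ≤ p.performance I :=
  div_nonneg (p.servedSum_nonneg _) (weightSum_nonneg _)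

theorem performance_le_one (I : Instance) : p.performance I ≤ 1 :=
  div_le_one_of_le₀ (p.servedSum_le_weightSum _) (weightSum_nonneg _)

variable {p}

theorem AgreeUpTo.refl (p : Itinerary) (t : ℝ) : p.AgreeUpTo p t := fun _ _ => rfl

theorem AgreeUpTo.symm {t : ℝ} (h : p.AgreeUpTo p' t) : p'.AgreeUpTo p t :=
  fun s hs => (h s hs).symm

theorem AgreeUpTo.mono {s t : ℝ} (h : p.AgreeUpTo p' t) (hst : s ≤ t) : p.AgreeUpTo p' s :=
  fun x hx => h x ⟨hx.1, hx.2.trans hst⟩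

theorem AgreeUpTo.trans {p'' : Itinerary} {t : ℝ} (h : p.AgreeUpTo p' t)
    (h' : p'.AgreeUpTo p'' t) : p.AgreeUpTo p'' t :=
  fun s hs => (h s hs).trans (h' s hs)

/-- A window that has closed by the time up to which two itineraries agree is treated equally
by both. -/
theorem AgreeUpTo.serves {f : Request} {t : ℝ} (h : p.AgreeUpTo p' t)
    (hf : f.release + 2 ≤ t) (hp : p.Serves f) : p'.Serves f := by
  obtain ⟨s, hs, hx⟩ := hp
  exact ⟨s, hs, by rw [← h s ⟨f.release_nonneg.trans hs.1, hs.2.trans hf⟩, hx]⟩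

variable (p)

/-- At any time `r` an itinerary can be changed so as to move to `x` at full speed and then to
stay there. -/
theorem exists_goto {r x : ℝ} (hr : 0 ≤ r) (hx : x ∈ Set.Icc (-1 : ℝ) 1) :
    ∃ p' : Itinerary, p.AgreeUpTo p' r ∧ ∀ t, r + |p.pos r - x| ≤ t → p'.pos t = x := by
  set y := p.pos r with hy
  have hym := p.pos_mem r hr
  rw [← hy] at hym
  -- the clamp of `x` to the interval of positions that are reachable from `y` by time `t`
  let g : ℝ → ℝ := fun t => max (y - (t - r)) (min (y + (t - r)) x)
  have hg0 : g r = y := by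
    simp only [g, sub_self, sub_zero, add_zero]
    exact max_eq_left (min_le_left _ _)
  have hgl : ∀ s t, |g s - g t| ≤ |s - t| := by
    intro s t
    refine (abs_max_sub_max_le_max _ _ _ _).trans (max_le ?_ ?_)
    · rw [show y - (s - r) - (y - (t - r)) = -(s - t) by ring, abs_neg]
    · refine (abs_min_sub_min_le_max _ _ _ _).trans (max_le ?_ ?_)
      · rw [show y + (s - r) - (y + (t - r)) = s - t by ring]
      · simp
  have hgm : ∀ t, r ≤ t → g t ∈ Set.Icc (-1 : ℝ) 1 := by
    intro t ht
    refine ⟨?_, ?_⟩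
    · refine le_max_of_le_right (le_min ?_ hx.1)
      linarith [hym.1]
    · refine max_le ?_ ((min_le_right _ _).trans hx.2)
      linarith [hym.2]
  have hmix : ∀ s t, 0 ≤ s → s ≤ r → r ≤ t → |p.pos s - g t| ≤ |s - t| := by
    intro s t hs hsr hrt
    have h1 := p.speed_le s r hs hr
    have h2 := hgl r t
    rw [hg0] at h2
    rw [← hy] at h1
    rw [abs_of_nonpos (by linarith : s - r ≤ 0)] at h1
    rw [abs_of_nonpos (by linarith : r - t ≤ 0)] at h2
    rw [abs_of_nonpos (by linarith : s - t ≤ 0)]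
    have := abs_sub_le (p.pos s) y (g t)
    linarith
  refine ⟨⟨fun t => if t ≤ r then p.pos t else g t, ?_, ?_, ?_⟩, ?_, ?_⟩
  · simp [hr, p.pos_zero]
  · intro t ht
    split_ifs with h
    · exact p.pos_mem t ht
    · exact hgm t (le_of_not_ge h)
  · intro s t hs ht
    split_ifs with h1 h2 h2
    · exact p.speed_le s t hs ht
    · exact hmix s t hs h1 (le_of_not_ge h2)
    · rw [abs_sub_comm, abs_sub_comm s]
      exact hmix t s ht h2 (le_of_not_ge h1)
    · exact hgl s t
  · intro s hs
    simp [hs.2]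
  · intro t ht
    have hyx := abs_nonneg (y - x)
    have h1 := le_abs_self (y - x)
    have h2 := neg_abs_le (y - x)
    dsimp only
    split_ifs with h
    · have h0 : |y - x| = 0 := by linarith
      have htr : t = r := by linarith
      rw [htr, ← hy]
      exact sub_eq_zero.1 (abs_eq_zero.1 h0)
    · simp only [g]
      rw [min_eq_right (by linarith), max_eq_right (by linarith)]

/-- The segment has length `2`, so a request can be served from any position at its release. -/
theorem exists_serves (f : Request) :
    ∃ p' : Itinerary, p.AgreeUpTo p' f.release ∧ p'.Serves f := by
  obtain ⟨p', h, hp'⟩ := p.exists_goto f.release_nonneg f.loc_mem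
  refine ⟨p', h, f.release + 2, ⟨by linarith, le_rfl⟩, hp' _ ?_⟩
  have h1 := p.pos_mem _ f.release_nonneg
  have h2 := f.loc_mem
  have : |p.pos f.release - f.loc| ≤ 2 :=
    abs_le.2 ⟨by linarith [h1.1, h2.2], by linarith [h1.2, h2.1]⟩
  linarith

/-- The itinerary that never leaves the origin. -/
def stay : Itinerary where
  pos _ := 0
  pos_zero := rfl
  pos_mem _ _ := by norm_num
  speed_le s t _ _ := by simp

instance : Nonempty Itinerary := ⟨stay⟩

end Itinerary

theorem Spaced.mono {S T : ℝ} {L : List Request} (h : Spaced T L) (hST : S ≤ T) : Spaced S L :=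
  List.Pairwise.imp (fun hfg => by linarith) h

theorem spaced_append_singleton {T : ℝ} {L : List Request} {f : Request} :
    Spaced T (L ++ [f]) ↔ Spaced T L ∧ ∀ g ∈ L, g.release + T ≤ f.release := by
  simp [Spaced, List.pairwise_append]

theorem bddAbove_performance (I : Instance) :
    BddAbove (Set.range fun p : Itinerary => p.performance I) :=
  ⟨1, by rintro _ ⟨p, rfl⟩; exact p.performance_le_one I⟩

theorem performance_le_optPerformance (p : Itinerary) (I : Instance) :
    p.performance I ≤ optPerformance I :=
  le_ciSup (bddAbove_performance I) p

theorem optPerformance_le_one (I : Instance) : optPerformance I ≤ 1 :=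
  ciSup_le fun p => p.performance_le_one I

theorem optPerformance_pos {I : Instance} (h : I.requests ≠ []) : 0 < optPerformance I := by
  obtain ⟨f, L, hL⟩ := List.exists_cons_of_ne_nil h
  obtain ⟨p, -, hp⟩ := Itinerary.stay.exists_serves f
  refine lt_of_lt_of_le ?_ (performance_le_optPerformance p I)
  rw [p.performance_eq]
  refine div_pos ?_ (weightSum_pos h)
  have := p.servedSum_append [f] L
  rw [Itinerary.servedSum_singleton hp] at this
  have h1 := p.servedSum_nonneg L
  have h2 := f.weight_pos
  simp only [List.singleton_append] at this
  rw [hL]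
  linarith

/-! ### The constant `alpha` -/

/-- All the ratios in the definition of `alpha` are below `c` for the weights in the list `l`.
For the last index `take` returns the whole list, as the definition of `alpha` requires. -/
def RatiosBelow (c : ℝ) (l : List ℝ) : Prop :=
  ∀ (i : ℕ) (h : i < l.length), l[i] < c * (l.take (i + 2)).sum

theorem sum_filter_le_eq_sum_take {m : ℕ} (δ : Fin m → ℝ) (i : ℕ) :
    ∑ k : Fin m with k.val ≤ i + 1, δ k = ((List.ofFn δ).take (i + 2)).sum := by
  rw [List.sum_take_ofFn]
  refine Finset.sum_congr ?_ fun _ _ => rfl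
  ext k
  simp only [Finset.mem_filter, Finset.mem_univ, true_and]
  omega

theorem sum_take_pos {l : List ℝ} (hl : ∀ x ∈ l, 0 < x) (hne : l ≠ []) (i : ℕ) :
    0 < (l.take (i + 1)).sum := by
  refine List.sum_pos _ (fun x hx => hl x (List.mem_of_mem_take hx)) ?_
  simpa using hne

theorem ratio_nonneg {m : ℕ} {δ : Fin m → ℝ} (hδ : ∀ i, 0 < δ i) (i : Fin m) :
    0 ≤ δ i / ∑ k : Fin m with k.val ≤ i.val + 1, δ k :=
  div_nonneg (hδ i).le (Finset.sum_nonneg fun k _ => (hδ k).le)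

theorem bddBelow_alpha (m : ℕ) :
    BddBelow (Set.range fun δ : {δ : Fin m → ℝ // ∀ i, 0 < δ i} =>
      ⨆ i : Fin m, δ.1 i / ∑ k : Fin m with k.val ≤ i.val + 1, δ.1 k) :=
  ⟨0, by rintro _ ⟨δ, rfl⟩; exact Real.iSup_nonneg fun i => ratio_nonneg δ.2 i⟩

theorem exists_ratiosBelow_of_alpha_lt {m : ℕ} {c : ℝ} (h : alpha m < c) :
    ∃ l : List ℝ, l.length = m ∧ (∀ x ∈ l, 0 < x) ∧ RatiosBelow c l := by
  have : Nonempty {δ : Fin m → ℝ // ∀ i, 0 < δ i} := ⟨⟨fun _ => 1, fun _ => one_pos⟩⟩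
  obtain ⟨⟨δ, hδ⟩, hc⟩ := exists_lt_of_ciInf_lt h
  have hpos : ∀ x ∈ List.ofFn δ, 0 < x := by
    intro x hx
    obtain ⟨i, rfl⟩ := (List.mem_ofFn' _ _).1 hx
    exact hδ i
  refine ⟨List.ofFn δ, List.length_ofFn, hpos, fun i hi => ?_⟩
  have hi' : i < m := by simpa using hi
  have h1 := (le_ciSup (Set.finite_range _).bddAbove (⟨i, hi'⟩ : Fin m)).trans_lt hc
  dsimp only at h1
  rw [sum_filter_le_eq_sum_take, div_lt_iff₀] at h1
  · simpa using h1
  · exact sum_take_pos hpos (List.ne_nil_of_length_pos (by omega)) _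

theorem alpha_length_lt {l : List ℝ} {c : ℝ} (hne : l ≠ []) (hl : ∀ x ∈ l, 0 < x)
    (h : RatiosBelow c l) : alpha l.length < c := by
  have hδ : ∀ i, 0 < l.get i := fun i => hl _ (List.get_mem _ _)
  refine (ciInf_le (bddBelow_alpha _) ⟨l.get, hδ⟩).trans_lt ?_
  have : Nonempty (Fin l.length) := ⟨⟨0, List.length_pos_of_ne_nil hne⟩⟩
  obtain ⟨i, hi⟩ := exists_eq_ciSup_of_finite
    (f := fun i : Fin l.length => l.get i / ∑ k : Fin l.length with k.val ≤ i.val + 1, l.get k)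
  dsimp only at hi ⊢
  rw [← hi, sum_filter_le_eq_sum_take, List.ofFn_get, div_lt_iff₀ (sum_take_pos hl hne _)]
  exact h i i.2

/-- A shorter list of weights gives no smaller ratios: a small weight can be put in front. -/
theorem alpha_lt_of_length_le {m : ℕ} {c : ℝ} {l : List ℝ} (hne : l ≠ [])
    (hl : ∀ x ∈ l, 0 < x) (h : RatiosBelow c l) (hm : l.length ≤ m) : alpha m < c := by
  induction hk : m - l.length generalizing l with
  | zero =>
    have : l.length = m := by omega
    rw [← this]
    exact alpha_length_lt hne hl h
  | succ k ih =>
    obtain ⟨x, l', rfl⟩ := List.exists_cons_of_ne_nil hne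
    have hx : 0 < x := hl x List.mem_cons_self
    have hc : 0 < c := by
      have h0 := h 0 (by simp)
      have h1 := sum_take_pos hl hne 1
      have h2 : 0 < c * ((x :: l').take 2).sum := hx.trans (by simpa using h0)
      exact pos_of_mul_pos_left h2 h1.le
    have he : 0 < c * x / 2 := by positivity
    refine ih (l := c * x / 2 :: x :: l') (by simp) ?_ ?_ ?_ ?_
    · intro y hy
      rcases List.mem_cons.1 hy with rfl | hy
      · exact he
      · exact hl y hy
    · intro i hi
      cases i with
      | zero =>
        simp only [List.getElem_cons_zero, List.take_succ_cons, List.sum_cons, List.take_zero,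
          List.sum_nil]
        nlinarith
      | succ i =>
        have := h i (by simpa using hi)
        rw [List.getElem_cons_succ, List.take_succ_cons, List.sum_cons, mul_add]
        have : 0 < c * (c * x / 2) := by positivity
        linarith
    · simp only [List.length_cons] at hk hm ⊢
      omega
    · simp only [List.length_cons] at hk hm ⊢
      omega

theorem alpha_le_one {m : ℕ} (hm : 1 ≤ m) : alpha m ≤ 1 := by
  refine (ciInf_le (bddBelow_alpha _) ⟨fun _ => 1, fun _ => one_pos⟩).trans ?_
  have : Nonempty (Fin m) := ⟨⟨0, hm⟩⟩
  refine ciSup_le fun i => div_le_one_of_le₀ ?_ (by positivity)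
  exact Finset.single_le_sum (f := fun _ : Fin m => (1 : ℝ)) (fun _ _ => zero_le_one)
    (Finset.mem_filter.2 ⟨Finset.mem_univ i, by omega⟩)

theorem alpha_nonneg (m : ℕ) : 0 ≤ alpha m :=
  Real.iInf_nonneg fun δ => Real.iSup_nonneg fun i => ratio_nonneg δ.2 i

theorem alpha_one : alpha 1 = 1 := by
  refine le_antisymm (alpha_le_one le_rfl) ?_
  have : Nonempty {δ : Fin 1 → ℝ // ∀ i, 0 < δ i} := ⟨⟨fun _ => 1, fun _ => one_pos⟩⟩
  refine le_ciInf fun δ => ?_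
  refine le_trans ?_ (le_ciSup (Set.finite_range _).bddAbove (0 : Fin 1))
  have h : (Finset.univ.filter fun k : Fin 1 => k.val ≤ (0 : Fin 1).val + 1) = {0} := by
    ext k
    simp [Subsingleton.elim k 0]
  rw [h, Finset.sum_singleton, div_self (δ.2 0).ne']

/-! ### Online algorithms that maintain an invariant -/

open scoped Classical in
/-- The itinerary chosen after the requests of a list, which is read with the newest request
first: whenever possible, the current itinerary is changed after the release of the newest
request so that the invariant `G` holds. -/
noncomputable def plan (G : List Request → Itinerary → Prop) : List Request → Itinerary
  | [] => Itinerary.stay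
  | f :: R =>
    if h : ∃ p', (plan G R).AgreeUpTo p' f.release ∧ G (f :: R) p' then h.choose else plan G R

theorem plan_agree_cons (G : List Request → Itinerary → Prop) (f : Request) (R : List Request) :
    (plan G R).AgreeUpTo (plan G (f :: R)) f.release := by
  rw [plan]
  split_ifs with h
  · exact h.choose_spec.1
  · exact .refl _ _

theorem plan_agree_append (G : List Request → Itinerary → Prop) (R S : List Request) {t : ℝ}
    (h : ∀ f ∈ S, t ≤ f.release) : (plan G R).AgreeUpTo (plan G (S ++ R)) t := by
  induction S with
  | nil => exact .refl _ _
  | cons f S ih =>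
    exact (ih fun g hg => h g (List.mem_cons_of_mem _ hg)).trans
      ((plan_agree_cons G f (S ++ R)).mono (h f List.mem_cons_self))

/-- In a list in order of release the requests released up to time `t` come first. -/
theorem exists_filter_append {L : List Request}
    (hL : L.Pairwise fun f g => f.release ≤ g.release) (t : ℝ) :
    ∃ M : List Request, L = L.filter (fun f => f.release ≤ t) ++ M ∧ ∀ f ∈ M, t < f.release := by
  induction L with
  | nil => exact ⟨[], by simp⟩
  | cons f L ih =>
    obtain ⟨h1, h2⟩ := List.pairwise_cons.1 hL
    by_cases hf : f.release ≤ t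
    · obtain ⟨M, hM, hM'⟩ := ih h2
      refine ⟨M, ?_, hM'⟩
      rw [List.filter_cons_of_pos (by simpa using hf), List.cons_append, ← hM]
    · have hall : ∀ g ∈ f :: L, t < g.release := by
        intro g hg
        rcases List.mem_cons.1 hg with rfl | hg
        · exact not_le.1 hf
        · exact (not_le.1 hf).trans_le (h1 g hg)
      refine ⟨f :: L, ?_, hall⟩
      rw [List.filter_eq_nil_iff.2 fun g hg => by simpa using hall g hg, List.nil_append]

/-- The online algorithm that maintains the invariant `G` as long as this is possible. -/
noncomputable def maintain (G : List Request → Itinerary → Prop) : OnlineAlgorithm where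
  run I := plan G I.requests.reverse
  causal I J t _ h := by
    obtain ⟨M, hM, hM'⟩ := exists_filter_append I.sorted t
    obtain ⟨N, hN, hN'⟩ := exists_filter_append J.sorted t
    have hI : I.requests = I.revealed t ++ M := by
      rw [Instance.revealed]; convert hM
    have hJ : J.requests = J.revealed t ++ N := by
      rw [Instance.revealed]; convert hN
    rw [hI, hJ, ← h, List.reverse_append, List.reverse_append]
    exact (plan_agree_append G _ _ fun f hf => (hM' f (List.mem_reverse.1 hf)).le).symm.trans
      (plan_agree_append G _ _ fun f hf => (hN' f (List.mem_reverse.1 hf)).le)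

/-- An invariant that can be kept up at every release is kept up by an online algorithm. -/
theorem exists_onlineAlgorithm {T : ℝ} {n : ℕ} (G : List Request → Itinerary → Prop)
    (h0 : G [] Itinerary.stay)
    (hstep : ∀ L f p, Spaced T (L ++ [f]) → (L ++ [f]).length ≤ n → G L p →
      ∃ p' : Itinerary, p.AgreeUpTo p' f.release ∧ G (L ++ [f]) p') :
    ∃ A : OnlineAlgorithm, ∀ I : Instance, Spaced T I.requests → I.requests.length ≤ n →
      G I.requests (A.run I) := by
  set H : List Request → Itinerary → Prop := fun R p => G R.reverse p with hH
  have key : ∀ R : List Request, Spaced T R.reverse → R.length ≤ n → H R (plan H R) := by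
    intro R
    induction R with
    | nil => intro _ _; exact h0
    | cons f R ih =>
      intro hs hl
      rw [List.reverse_cons] at hs
      have hR := ih (spaced_append_singleton.1 hs).1
        ((Nat.le_succ _).trans (by simpa using hl))
      have hex : ∃ p', (plan H R).AgreeUpTo p' f.release ∧ H (f :: R) p' := by
        obtain ⟨p', h1, h2⟩ := hstep _ f _ hs (by simpa using hl) hR
        exact ⟨p', h1, by simpa [hH] using h2⟩
      rw [plan, dif_pos hex]
      exact hex.choose_spec.2
  refine ⟨maintain H, fun I hs hl => ?_⟩
  have := key I.requests.reverse (by simpa using hs) (by simpa using hl)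
  simpa [hH, maintain] using this

/-! ### The online algorithm -/

/-- All requests are served, each of them before the next request can be released; at that time
the vehicle has come back to within `L.length * u` of the origin. -/
def AllServed (u : ℝ) (L : List Request) (p : Itinerary) : Prop :=
  ∀ r, 0 ≤ r → (∀ f ∈ L, f.release + (2 - u) ≤ r) →
    |p.pos r| ≤ L.length * u ∧
      ∀ f ∈ L, ∃ t ∈ Set.Icc f.release (f.release + 2), t ≤ r ∧ p.pos t = f.loc

/-- The newest request is skipped, and the requests before it contribute enough weight. -/
def Rests (c : ℝ) (L : List Request) (p : Itinerary) : Prop :=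
  ∃ B h, L = B ++ [h] ∧ c * weightSum L ≤ p.servedSum B

/-- The newest request `g` will be served. The requests in `C` were pursued and then skipped, one
after the other, because none of them was worth staying with. -/
def Pursues (q : ℕ) (c : ℝ) (L : List Request) (p : Itinerary) : Prop :=
  ∃ A C g, L = A ++ C ++ [g] ∧ q ≤ A.length ∧ p.Serves g ∧
    c * weightSum A ≤ p.servedSum A ∧ c * weightSum L ≤ p.servedSum A + g.weight ∧
    ∀ (i : ℕ) (h : i < C.length),
      C[i].weight < c * weightSum ((C ++ [g]).take (i + 2))

theorem allServed_append {u : ℝ} (hu : 0 ≤ u) {L : List Request} {f : Request} {p : Itinerary}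
    (h : AllServed u L p) (hs : Spaced (2 - u) (L ++ [f])) (hl : (L.length + 1) * u ≤ 1) :
    ∃ p' : Itinerary, p.AgreeUpTo p' f.release ∧ AllServed u (L ++ [f]) p' := by
  have hrel := (spaced_append_singleton.1 hs).2
  obtain ⟨hpos, hserve⟩ := h f.release f.release_nonneg hrel
  obtain ⟨p₁, ha₁, hx₁⟩ := p.exists_goto f.release_nonneg f.loc_mem
  set D := |p.pos f.release - f.loc| with hD
  have hloc : |f.loc| ≤ 1 := abs_le.2 f.loc_mem
  have hD0 : 0 ≤ D := abs_nonneg _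
  have hD1 : D ≤ L.length * u + 1 := by
    have := abs_sub (p.pos f.release) f.loc
    linarith
  have hσ : 0 ≤ f.release + D := add_nonneg f.release_nonneg hD0
  obtain ⟨p₂, ha₂, hx₂⟩ := p₁.exists_goto hσ (x := 0) (by norm_num)
  rw [hx₁ _ le_rfl, sub_zero] at hx₂
  have hat : p₂.pos (f.release + D) = f.loc := by
    rw [← ha₂ _ ⟨hσ, le_rfl⟩, hx₁ _ le_rfl]
  have hagree : p.AgreeUpTo p₂ f.release := ha₁.trans (ha₂.mono (by linarith))
  refine ⟨p₂, hagree, fun r hr hall => ?_⟩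
  have hrf : f.release + (2 - u) ≤ r := hall f (by simp)
  have hlu : 0 ≤ (L.length : ℝ) * u := by positivity
  refine ⟨?_, fun g hg => ?_⟩
  · rw [List.length_append, List.length_singleton, Nat.cast_add, Nat.cast_one]
    have h0 := abs_nonneg f.loc
    rcases le_total (f.release + D + |f.loc|) r with h1 | h1
    · rw [hx₂ r h1, abs_zero]
      nlinarith
    · have := p₂.speed_le r _ hr (hr.trans h1)
      rw [hx₂ _ le_rfl, sub_zero, abs_of_nonpos (by linarith : r - _ ≤ 0)] at this
      linarith
  · rcases List.mem_append.1 hg with hg | hg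
    · obtain ⟨t, ht, htf, hp⟩ := hserve g hg
      refine ⟨t, ht, by linarith, ?_⟩
      rw [← hagree t ⟨g.release_nonneg.trans ht.1, htf⟩, hp]
    · obtain rfl := List.mem_singleton.1 hg
      exact ⟨g.release + D, ⟨by linarith, by linarith⟩, by linarith, hat⟩

/-- A request that arrives when all others are served can be pursued. -/
theorem pursues_of_allServed {u c : ℝ} (hc : c ≤ 1) {q : ℕ} {L : List Request}
    {f : Request} {p : Itinerary} (h : AllServed u L p) (hs : Spaced (2 - u) (L ++ [f]))
    (hl : q ≤ L.length) :
    ∃ p' : Itinerary, p.AgreeUpTo p' f.release ∧ Pursues q c (L ++ [f]) p' := by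
  have hrel := (spaced_append_singleton.1 hs).2
  obtain ⟨-, hserve⟩ := h f.release f.release_nonneg hrel
  obtain ⟨p', ha, hp'⟩ := p.exists_serves f
  have hL : p'.servedSum L = weightSum L := by
    refine Itinerary.servedSum_eq_weightSum fun g hg => ?_
    obtain ⟨t, ht, htf, hp⟩ := hserve g hg
    exact ⟨t, ht, by rw [← ha t ⟨g.release_nonneg.trans ht.1, htf⟩, hp]⟩
  have hw := weightSum_nonneg L
  have hf := f.weight_pos
  refine ⟨p', ha, L, [], f, by simp, hl, hp', ?_, ?_, by simp⟩
  · rw [hL]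
    nlinarith
  · rw [hL, weightSum_append, weightSum_singleton]
    nlinarith

theorem pursues_of_rests {c : ℝ} (hc : c ≤ 1) {q : ℕ} {L : List Request}
    {f : Request} {p : Itinerary} (h : Rests c L p) (hs : Spaced 1 (L ++ [f]))
    (hl : q ≤ L.length) :
    ∃ p' : Itinerary, p.AgreeUpTo p' f.release ∧ Pursues q c (L ++ [f]) p' := by
  obtain ⟨B, h, rfl, hB⟩ := h
  obtain ⟨p', ha, hp'⟩ := p.exists_serves f
  obtain ⟨hs1, hs2⟩ := spaced_append_singleton.1 hs
  have hmono : p.servedSum B ≤ p'.servedSum B := by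
    refine Itinerary.servedSum_mono fun g hg hp => ha.serves ?_ hp
    have h1 := (spaced_append_singleton.1 hs1).2 g hg
    have h2 := hs2 h (by simp)
    linarith
  have hf := f.weight_pos
  have hBh : p'.servedSum B ≤ p'.servedSum (B ++ [h]) := by
    rw [p'.servedSum_append]
    linarith [p'.servedSum_nonneg [h]]
  refine ⟨p', ha, B ++ [h], [], f, by simp, hl, hp', by linarith, ?_, by simp⟩
  rw [weightSum_append _ [f], weightSum_singleton]
  nlinarith

/-- If neither staying with the pursued request nor switching to the new one gave the fraction `c`
of the weight, the skipped requests would violate the definition of `alpha`. -/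
theorem rests_or_pursues_of_pursues {c : ℝ} {n q : ℕ} (hc : c ≤ alpha (n - q))
    {L : List Request} {f : Request} {p : Itinerary} (h : Pursues q c L p)
    (hs : Spaced 1 (L ++ [f])) (hl : (L ++ [f]).length ≤ n) :
    ∃ p' : Itinerary, p.AgreeUpTo p' f.release ∧
      (Rests c (L ++ [f]) p' ∨ Pursues q c (L ++ [f]) p') := by
  obtain ⟨A, C, g, rfl, hq, hg, hA, hL, hC⟩ := h
  by_cases hstay : c * weightSum (A ++ C ++ [g] ++ [f]) ≤ p.servedSum A + g.weight
  · refine ⟨p, .refl _ _, Or.inl ⟨A ++ C ++ [g], f, rfl, hstay.trans ?_⟩⟩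
    rw [p.servedSum_append, p.servedSum_append, Itinerary.servedSum_singleton hg]
    linarith [p.servedSum_nonneg C]
  · rw [not_le] at hstay
    obtain ⟨p', ha, hp'⟩ := p.exists_serves f
    obtain ⟨hs1, hs2⟩ := spaced_append_singleton.1 hs
    have hmono : p.servedSum A ≤ p'.servedSum A := by
      refine Itinerary.servedSum_mono fun a haA hp => ha.serves ?_ hp
      have h1 := (spaced_append_singleton.1 hs1).2 a (by simp [haA])
      have h2 := hs2 g (by simp)
      linarith
    have hsplit : weightSum (A ++ C ++ [g] ++ [f]) =
        weightSum A + weightSum (C ++ [g] ++ [f]) := by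
      simp only [weightSum_append]
      ring
    have hchain : ∀ (i : ℕ) (h : i < (C ++ [g]).length),
        (C ++ [g])[i].weight < c * weightSum ((C ++ [g] ++ [f]).take (i + 2)) := by
      intro i hi
      rw [List.length_append, List.length_singleton] at hi
      rcases Nat.lt_succ_iff_lt_or_eq.1 hi with hlt | rfl
      · rw [List.getElem_append_left hlt, List.take_append_of_le_length (by simp; omega)]
        exact hC i hlt
      · rw [List.getElem_concat_length (by simp), List.take_of_length_le (by simp)]
        rw [hsplit, mul_add] at hstay
        linarith
    refine ⟨p', ha, Or.inr ⟨A, C ++ [g], f, by simp, hq, hp', by linarith, ?_, hchain⟩⟩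
    by_contra hcon
    rw [not_le] at hcon
    refine absurd hc (not_le.2 ?_)
    refine alpha_lt_of_length_le (l := (C ++ [g] ++ [f]).map Request.weight) (by simp) ?_ ?_ ?_
    · intro x hx
      obtain ⟨a, -, rfl⟩ := List.mem_map.1 hx
      exact a.weight_pos
    · intro i hi
      rw [← List.map_take, List.getElem_map]
      rw [List.length_map, List.length_append, List.length_singleton] at hi
      rcases Nat.lt_succ_iff_lt_or_eq.1 hi with hlt | rfl
      · rw [List.getElem_append_left hlt]
        exact hchain i hlt
      · rw [List.getElem_concat_length (by simp), List.take_of_length_le (by simp)]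
        rw [hsplit, mul_add] at hcon
        change _ < c * weightSum (C ++ [g] ++ [f])
        linarith
    · simp only [List.length_append, List.length_map, List.length_singleton] at hl ⊢
      omega

/-- As long as at most `q` requests are released all of them can be served, since `q * u ≤ 1`.
From then on at most `n - q` requests can take part in a sequence of conflicts. -/
theorem exists_onlineAlgorithm_alpha_le {n q : ℕ} {u : ℝ} (hu : 0 ≤ u) (hu1 : u ≤ 1)
    (hqu : q * u ≤ 1) (hqn : q < n) :
    ∃ A : OnlineAlgorithm, ∀ I : Instance, I.requests ≠ [] → Spaced (2 - u) I.requests →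
      I.requests.length ≤ n → alpha (n - q) ≤ (A.run I).performance I := by
  set c := alpha (n - q) with hc
  have hc1 : c ≤ 1 := alpha_le_one (by omega)
  obtain ⟨A, hA⟩ := exists_onlineAlgorithm (T := 2 - u) (n := n)
    (fun L p => (L.length ≤ q ∧ AllServed u L p) ∨ (q < L.length ∧ Rests c L p) ∨
      (q < L.length ∧ Pursues q c L p))
    (Or.inl ⟨Nat.zero_le _, fun r _ _ => by simp [Itinerary.stay]⟩) (by
      intro L f p hs hl hG
      have hs1 : Spaced 1 (L ++ [f]) := hs.mono (by linarith)
      have hlen : (L ++ [f]).length = L.length + 1 := by simp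
      rcases hG with ⟨h1, h2⟩ | ⟨h1, h2⟩ | ⟨h1, h2⟩
      · rcases h1.lt_or_eq with h3 | h3
        · have : ((L.length : ℝ) + 1) * u ≤ 1 := by
            refine le_trans (mul_le_mul_of_nonneg_right ?_ hu) hqu
            exact_mod_cast h3
          obtain ⟨p', ha, hp'⟩ := allServed_append hu h2 hs this
          exact ⟨p', ha, Or.inl ⟨by omega, hp'⟩⟩
        · obtain ⟨p', ha, hp'⟩ := pursues_of_allServed hc1 h2 hs h3.ge
          exact ⟨p', ha, Or.inr (Or.inr ⟨by omega, hp'⟩)⟩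
      · obtain ⟨p', ha, hp'⟩ := pursues_of_rests hc1 h2 hs1 h1.le
        exact ⟨p', ha, Or.inr (Or.inr ⟨by omega, hp'⟩)⟩
      · obtain ⟨p', ha, hp'⟩ := rests_or_pursues_of_pursues hc.le h2 hs1 hl
        exact ⟨p', ha, Or.inr (hp'.imp (fun h => ⟨by omega, h⟩) fun h => ⟨by omega, h⟩)⟩)
  refine ⟨A, fun I hne hs hl => ?_⟩
  rw [Itinerary.performance_eq, le_div_iff₀ (weightSum_pos hne)]
  rcases hA I hs hl with ⟨-, h⟩ | ⟨-, B, h, hB, hsum⟩ | ⟨-, B, C, g, hB, -, hg, -, hsum, -⟩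
  · -- all requests are served by the time `r`, which only has to be late enough
    obtain ⟨r, hr⟩ : ∃ r : ℝ, 0 ≤ r ∧ ∀ f ∈ I.requests, f.release + (2 - u) ≤ r := by
      obtain ⟨M, hM⟩ := ((List.finite_toSet I.requests).image
        fun f => f.release + (2 - u)).bddAbove
      refine ⟨max 0 M, le_max_left _ _, fun f hf => (hM ⟨f, hf, rfl⟩).trans (le_max_right _ _)⟩
    rw [Itinerary.servedSum_eq_weightSum fun f hf => ?_]
    · nlinarith [weightSum_nonneg I.requests]
    · obtain ⟨t, ht, -, hp⟩ := (h r hr.1 hr.2).2 f hf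
      exact ⟨t, ht, hp⟩
  · refine hsum.trans ?_
    rw [hB, Itinerary.servedSum_append]
    linarith [(A.run I).servedSum_nonneg [h]]
  · refine hsum.trans ?_
    rw [hB, Itinerary.servedSum_append, Itinerary.servedSum_append,
      Itinerary.servedSum_singleton hg]
    linarith [(A.run I).servedSum_nonneg C]

/-! ### The adversary -/

/-- A list of weights can be preceded by `q` weights that grow so fast that each of them, and also
the first weight of the list, outweighs `1 / c` times everything before it, and still so small that
they can be added to the numerators in `RatiosBelow`. -/
theorem exists_small_weights {c d₀ : ℝ} (hc : 0 < c) (hd₀ : 0 < d₀) {d : List ℝ}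
    (hd : RatiosBelow c d) (q : ℕ) :
    ∃ b : List ℝ, b.length = q ∧ (∀ x ∈ b, 0 < x) ∧
      (∀ (i : ℕ) (h : i < (b ++ [d₀]).length),
        ((b ++ [d₀]).take i).sum < c * (b ++ [d₀])[i]) ∧
      ∀ (i : ℕ) (h : i < d.length), b.sum + d[i] < c * (d.take (i + 2)).sum := by
  induction q with
  | zero =>
    refine ⟨[], rfl, by simp, fun i hi => ?_, fun i hi => by simpa using hd i hi⟩
    obtain rfl : i = 0 := by simpa using hi
    simpa using mul_pos hc hd₀
  | succ q ih =>
    obtain ⟨b, hb, hpos, h1, h2⟩ := ih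
    obtain ⟨e₁, he₁, h1⟩ := Pi.exists_forall_pos_add_lt
      (x := fun i : Fin (b ++ [d₀]).length => ((b ++ [d₀]).take i).sum)
      (y := fun i => c * (b ++ [d₀])[i]) fun i => h1 i i.2
    obtain ⟨e₂, he₂, h2⟩ := Pi.exists_forall_pos_add_lt
      (x := fun i : Fin d.length => b.sum + d[i])
      (y := fun i => c * (d.take (i + 2)).sum) fun i => h2 i i.2
    have he : 0 < min e₁ e₂ := lt_min he₁ he₂
    refine ⟨min e₁ e₂ :: b, by simp [hb], ?_, fun i hi => ?_, fun i hi => ?_⟩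
    · intro x hx
      rcases List.mem_cons.1 hx with rfl | hx
      · exact he
      · exact hpos x hx
    · cases i with
      | zero => simpa only [List.take_zero, List.sum_nil, List.cons_append,
          List.getElem_cons_zero] using mul_pos hc he
      | succ i =>
        have := h1 ⟨i, by simpa using hi⟩
        simp only [List.cons_append, List.take_succ_cons, List.sum_cons, List.getElem_cons_succ]
        dsimp only [Fin.getElem_fin] at this
        linarith [min_le_left e₁ e₂]
    · have := h2 ⟨i, hi⟩
      dsimp only [Fin.getElem_fin] at this
      rw [List.sum_cons]
      linarith [min_le_right e₁ e₂]

theorem Itinerary.continuousOn_pos (p : Itinerary) : ContinuousOn p.pos (Set.Ici 0) := by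
  have : LipschitzOnWith 1 p.pos (Set.Ici 0) :=
    LipschitzOnWith.of_dist_le_mul fun s hs t ht => by
      simpa [Real.dist_eq] using p.speed_le s t hs ht
  exact this.continuousOn

/-- Until a further request is released the algorithm does not know of it. By continuity this
includes the moment of release. -/
theorem OnlineAlgorithm.agreeUpTo_run (A : OnlineAlgorithm) {I J : Instance} {f : Request}
    (h : J.requests = I.requests ++ [f]) : (A.run I).AgreeUpTo (A.run J) f.release := by
  have hlt : ∀ t, 0 ≤ t → t < f.release → (A.run I).pos t = (A.run J).pos t := by
    intro t ht htf
    refine A.causal I J t ht ?_ t ⟨ht, le_rfl⟩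
    simp [Instance.revealed, h, List.filter_append, not_le.2 htf]
  intro s hs
  rcases hs.2.lt_or_eq with h1 | h1
  · exact hlt s hs.1 h1
  rcases hs.1.lt_or_eq with h0 | h0
  · by_contra hne
    have hpos : 0 < |(A.run I).pos s - (A.run J).pos s| := abs_pos.2 (sub_ne_zero.2 hne)
    obtain ⟨t, ht, hts⟩ := exists_between
      (max_lt h0 (by linarith : s - |(A.run I).pos s - (A.run J).pos s| / 2 < s))
    have ht0 : 0 ≤ t := (le_max_left _ _).trans ht.le
    have ht1 := (le_max_right _ _).trans_lt ht
    have e1 := (A.run I).speed_le s t hs.1 ht0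
    have e2 := (A.run J).speed_le t s ht0 hs.1
    have e3 := abs_sub_le ((A.run I).pos s) ((A.run I).pos t) ((A.run J).pos s)
    rw [hlt t ht0 (by linarith)] at e1 e3
    rw [abs_of_pos (by linarith : 0 < s - t)] at e1
    rw [abs_of_neg (by linarith : t - s < 0)] at e2
    linarith
  · rw [← h0, (A.run I).pos_zero, (A.run J).pos_zero]

/-- The release time `r` of the request that follows a request `g` at an end of the segment. A
vehicle at distance `D` from `g` at the release of `g` can have moved away from `g` by at most
`T - D` at time `g.release + T`, provided that it has served `g` by then. Otherwise, and always if
`D > T`, the adversary can wait until the vehicle is about to serve `g`, and is then at distance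
almost `2` from the other end. -/
theorem Itinerary.exists_next_release (p : Itinerary) {g : Request} {T η D : ℝ} (hT : 0 ≤ T)
    (hT2 : T < 2) (hη : 0 < η) (hloc : |g.loc| = 1) (hg : p.Serves g)
    (hD : D ≤ |p.pos g.release - g.loc|) :
    ∃ r, g.release + T ≤ r ∧ r ≤ g.release + 2 ∧ min (2 - η) (D + 2 - T) ≤ |p.pos r + g.loc| ∧
      (T < D → 2 - η ≤ |p.pos r + g.loc| ∧ g.release + D - η ≤ r ∧
        ∀ t ∈ Set.Icc g.release r, p.pos t ≠ g.loc) := by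
  have hr0 := g.release_nonneg
  -- the first visit
  obtain ⟨a, ⟨hat, hax⟩, hmin⟩ : ∃ a,
      IsLeast (Set.Icc g.release (g.release + 2) ∩ p.pos ⁻¹' {g.loc}) a := by
    refine IsCompact.exists_isLeast ?_ ?_
    · refine isCompact_Icc.of_isClosed_subset ?_ Set.inter_subset_left
      exact (p.continuousOn_pos.mono fun t ht => hr0.trans ht.1).preimage_isClosed_of_isClosed
        isClosed_Icc isClosed_singleton
    · obtain ⟨t, ht, hx⟩ := hg
      exact ⟨t, ht, hx⟩
  rw [Set.mem_preimage, Set.mem_singleton_iff] at hax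
  have hDa : g.release + D ≤ a := by
    have := p.speed_le g.release a hr0 (hr0.trans hat.1)
    rw [hax, abs_of_nonpos (by linarith [hat.1] : g.release - a ≤ 0)] at this
    linarith
  have hopp : ∀ r, 0 ≤ r → 2 - |r - a| ≤ |p.pos r + g.loc| := by
    intro r hr
    have h1 := p.speed_le r a hr (hr0.trans hat.1)
    rw [hax] at h1
    have h2 := abs_sub (p.pos r + g.loc) (p.pos r - g.loc)
    rw [show p.pos r + g.loc - (p.pos r - g.loc) = 2 * g.loc by ring, abs_mul, hloc,
      abs_of_pos (by norm_num : (0 : ℝ) < 2)] at h2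
    linarith
  rcases le_or_gt a (g.release + T) with h | h
  · refine ⟨g.release + T, le_rfl, by linarith, ?_, fun hlt => by linarith⟩
    have := hopp (g.release + T) (by linarith)
    rw [abs_of_nonneg (by linarith)] at this
    exact (min_le_right _ _).trans (by linarith)
  · have hra : max (g.release + T) (a - η) < a := max_lt h (by linarith)
    have h1 := le_max_left (g.release + T) (a - η)
    have h2 := le_max_right (g.release + T) (a - η)
    generalize max (g.release + T) (a - η) = r at hra h1 h2
    have h3 := hopp r (by linarith)
    rw [abs_of_neg (by linarith)] at h3
    refine ⟨r, h1, by linarith [hat.2], (min_le_left _ _).trans (by linarith),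
      fun _ => ⟨by linarith, by linarith, fun t ht hx => ?_⟩⟩
    have := hmin ⟨⟨ht.1, by linarith [ht.2, hat.2]⟩, hx⟩
    linarith [ht.2]

theorem exists_instance_append {n : ℕ} {T : ℝ} (hT : 0 ≤ T) {I : Instance}
    (hI : I.requests = [] ∨ I ∈ instanceClass n T) (hl : I.requests.length < n) {f : Request}
    (hf : ∀ g ∈ I.requests, g.release + T ≤ f.release) :
    ∃ J ∈ instanceClass n T, J.requests = I.requests ++ [f] := by
  have hs : Spaced T (I.requests ++ [f]) := by
    refine spaced_append_singleton.2 ⟨?_, hf⟩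
    rcases hI with h | h
    · rw [h]; exact List.Pairwise.nil
    · exact h.2.2
  exact ⟨⟨I.requests ++ [f], hs.imp fun h => by linarith⟩, ⟨by simp, by simpa using hl, hs⟩, rfl⟩

/-- On every instance of the class the algorithm serves more than the fraction `c` of the weight
that any itinerary serves. -/
def OnlineAlgorithm.Beats (A : OnlineAlgorithm) (n : ℕ) (T c : ℝ) : Prop :=
  ∀ I ∈ instanceClass n T, ∀ o : Itinerary,
    c * o.servedSum I.requests < (A.run I).servedSum I.requests

theorem OnlineAlgorithm.Beats.serves_last {A : OnlineAlgorithm} {n : ℕ} {T c : ℝ}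
    (h : A.Beats n T c) (hc : 0 < c) {I : Instance} (hI : I ∈ instanceClass n T)
    {B : List Request} {g : Request} (hB : I.requests = B ++ [g])
    (hw : weightSum B < c * g.weight) : (A.run I).Serves g := by
  by_contra hg
  obtain ⟨o, -, ho⟩ := Itinerary.stay.exists_serves g
  have h1 := h I hI o
  rw [hB, Itinerary.servedSum_append, Itinerary.servedSum_append,
    Itinerary.servedSum_singleton ho, Itinerary.servedSum_singleton_of_not hg] at h1
  have h2 := (A.run I).servedSum_le_weightSum B
  have h3 := mul_nonneg hc.le (o.servedSum_nonneg B)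
  linarith

/-- The first phase: requests with fast growing weights, which must all be pursued, put the vehicle
further and further away from the next request. -/
theorem OnlineAlgorithm.Beats.first_phase {A : OnlineAlgorithm} {n : ℕ} {T c η : ℝ}
    (h : A.Beats n T c) (hc : 0 < c) (hT : 1 ≤ T) (hT2 : T < 2) (hη : 0 < η)
    {v : List ℝ} (hvn : v.length ≤ n) (hpos : ∀ x ∈ v, 0 < x)
    (hv : ∀ (i : ℕ) (h : i < v.length), (v.take i).sum < c * v[i]) (k : ℕ) (hk : k < v.length) :
    ∃ I ∈ instanceClass n T, ∃ B g, I.requests = B ++ [g] ∧ B.map Request.weight = v.take k ∧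
      g.weight = v[k] ∧ |g.loc| = 1 ∧ (0 < k → 1 ≤ g.release) ∧
      min (2 - η) (1 + k * (2 - T)) ≤ |(A.run I).pos g.release - g.loc| := by
  induction k with
  | zero =>
    let f : Request := ⟨1, 0, v[0], by norm_num, le_rfl, hpos _ (List.getElem_mem _)⟩
    obtain ⟨J, hJ, hJr⟩ := exists_instance_append (n := n) (T := T) (by linarith)
      (I := ⟨[], List.Pairwise.nil⟩) (Or.inl rfl) (by simp; omega) (f := f) (by simp)
    refine ⟨J, hJ, [], f, hJr, by simp, rfl, by simp [f], by simp, ?_⟩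
    simp [f, (A.run J).pos_zero]
  | succ k ih =>
    obtain ⟨I, hI, B, g, hB, hmap, hw, hloc, -, hdist⟩ := ih (by omega)
    have hBsum : weightSum B = (v.take k).sum := by rw [weightSum, hmap]
    have hserve := h.serves_last hc hI hB (by rw [hBsum, hw]; exact hv k (by omega))
    obtain ⟨r, hr1, -, hr3, -⟩ := (A.run I).exists_next_release (by linarith) hT2 hη hloc hserve
      hdist
    have hr0 := g.release_nonneg
    have hm : -g.loc ∈ Set.Icc (-1 : ℝ) 1 := ⟨by linarith [g.loc_mem.2], by linarith [g.loc_mem.1]⟩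
    let f : Request := ⟨-g.loc, r, v[k + 1], hm, by linarith, hpos _ (List.getElem_mem _)⟩
    have hlenB : B.length = k := by
      rw [← List.length_map (f := Request.weight), hmap, List.length_take]
      omega
    obtain ⟨J, hJ, hJr⟩ := exists_instance_append (n := n) (T := T) (by linarith) (Or.inr hI)
      (by rw [hB]; simp; omega) (f := f) (by
        intro a ha
        rw [hB, List.mem_append, List.mem_singleton] at ha
        rcases ha with ha | rfl
        · have := (spaced_append_singleton.1 (hB ▸ hI.2.2 : Spaced T (B ++ [g]))).2 a ha
          change a.release + T ≤ r
          linarith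
        · exact hr1)
    have hagree := A.agreeUpTo_run hJr
    refine ⟨J, hJ, B ++ [g], f, by rw [hJr, hB], ?_, rfl, by simpa [f] using hloc, ?_, ?_⟩
    · rw [List.map_append, hmap, List.map_singleton, hw, List.take_append_getElem]
    · intro _
      change 1 ≤ r
      linarith
    · have e : (A.run J).pos r = (A.run I).pos r :=
        (hagree r ⟨by linarith, le_rfl⟩).symm
      change _ ≤ |(A.run J).pos r - -g.loc|
      rw [e, sub_neg_eq_add]
      refine le_trans (le_min (min_le_left _ _) ?_) hr3
      push_cast
      rcases min_choice (2 - η) (1 + k * (2 - T)) with e | e <;> rw [e]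
      · exact (min_le_left _ _).trans (by linarith)
      · exact (min_le_right _ _).trans (by linarith)

/-- The second phase: whenever the vehicle is about to serve a request `g`, the next request
appears at the other end, so that the vehicle cannot serve both. An itinerary that knows the
instance can shuttle between the ends and serve all these requests. It is at `g` at time `s`. -/
theorem OnlineAlgorithm.Beats.second_phase {A : OnlineAlgorithm} {n : ℕ} {T c η : ℝ}
    (h : A.Beats n T c) (hc : 0 < c) (hT : 1 ≤ T) (hT2 : T < 2) (hη : 0 < η) (hηT : η < 2 - T)
    (hηn : 2 * η * n ≤ 1) {b d : List ℝ} (hlen : b.length + d.length ≤ n)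
    (hposd : ∀ x ∈ d, 0 < x) (hd0 : 0 < d.length) (hbd : b.sum < c * d[0])
    (hd : ∀ (i : ℕ) (h : i < d.length), b.sum + d[i] < c * (d.take (i + 2)).sum)
    (h0 : ∃ I ∈ instanceClass n T, ∃ B g, I.requests = B ++ [g] ∧ B.map Request.weight = b ∧
      g.weight = d[0] ∧ |g.loc| = 1 ∧ 1 ≤ g.release ∧
      T < |(A.run I).pos g.release - g.loc|) (j : ℕ) (hj : j < d.length) :
    ∃ I ∈ instanceClass n T, ∃ (B C : List Request) (g : Request) (o : Itinerary) (D s : ℝ),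
      I.requests = B ++ C ++ [g] ∧
      B.map Request.weight = b ∧ C.map Request.weight = d.take j ∧ g.weight = d[j] ∧
      |g.loc| = 1 ∧ T < D ∧ D ≤ |(A.run I).pos g.release - g.loc| ∧
      (∀ f ∈ C, ¬ (A.run I).Serves f) ∧
      (∀ f ∈ C, ∃ t ∈ Set.Icc f.release (f.release + 2), t ≤ s ∧ o.pos t = f.loc) ∧
      o.Serves g ∧ o.pos s = g.loc ∧ g.release ≤ s ∧ s - g.release + 1 ≤ D + 2 * η * j := by
  induction j with
  | zero =>
    obtain ⟨I, hI, B, g, hB, hmap, hw, hloc, hrel, hdist⟩ := h0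
    obtain ⟨o, -, ho⟩ := Itinerary.stay.exists_goto le_rfl g.loc_mem
    have ho' : o.pos g.release = g.loc := by
      refine ho _ ?_
      simpa [Itinerary.stay, hloc] using hrel
    exact ⟨I, hI, B, [], g, o, _, g.release, by simpa using hB, hmap, by simp, hw, hloc, hdist,
      le_rfl, by simp, by simp, ⟨g.release, ⟨le_rfl, by linarith⟩, ho'⟩, ho', le_rfl,
      by simp; linarith⟩
  | succ j ih =>
    obtain ⟨I, hI, B, C, g, o, D, s, hB, hmapB, hmapC, hw, hloc, hTD, hdist, hC, hoC, hog, hos,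
      hgs, hsD⟩ := ih (by omega)
    have hBsum : weightSum B = b.sum := by rw [weightSum, hmapB]
    have hCsum : weightSum C = (d.take j).sum := by rw [weightSum, hmapC]
    have hoC' : o.servedSum C = weightSum C := by
      refine Itinerary.servedSum_eq_weightSum fun f hf => ?_
      obtain ⟨t, ht, -, hx⟩ := hoC f hf
      exact ⟨t, ht, hx⟩
    have hserve : (A.run I).Serves g := by
      by_contra hg
      have h1 := h I hI o
      rw [hB] at h1
      simp only [Itinerary.servedSum_append] at h1
      rw [Itinerary.servedSum_singleton hog, Itinerary.servedSum_singleton_of_not hg,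
        Itinerary.servedSum_eq_zero hC, hoC', hCsum, hw] at h1
      have h2 := (A.run I).servedSum_le_weightSum B
      have h3 := mul_nonneg hc.le (o.servedSum_nonneg B)
      have h4 : d[0] ≤ (d.take j).sum + d[j] := by
        have hsum : (d.take j).sum + d[j] = (d.take (j + 1)).sum := by
          rw [List.sum_take_succ]
        rw [hsum]
        refine List.single_le_sum (fun x hx => (hposd x (List.mem_of_mem_take hx)).le) _ ?_
        exact List.mem_take_iff_getElem.2 ⟨0, by simp; omega, rfl⟩
      have h5 := mul_le_mul_of_nonneg_left h4 hc.le
      rw [hBsum] at h2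
      linarith
    obtain ⟨r, hr1, hr2, -, hr3⟩ := (A.run I).exists_next_release (by linarith) hT2 hη hloc hserve
      hdist
    obtain ⟨hr4, hr5, hr6⟩ := hr3 hTD
    have hr0 := g.release_nonneg
    have hm : -g.loc ∈ Set.Icc (-1 : ℝ) 1 := ⟨by linarith [g.loc_mem.2], by linarith [g.loc_mem.1]⟩
    let f : Request := ⟨-g.loc, r, d[j + 1], hm, by linarith, hposd _ (List.getElem_mem _)⟩
    have hprev := (spaced_append_singleton.1 (hB ▸ hI.2.2 : Spaced T (B ++ C ++ [g]))).2
    have hlenB : B.length = b.length := by rw [← hmapB, List.length_map]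
    have hlenC : C.length = j := by
      rw [← List.length_map (f := Request.weight), hmapC, List.length_take]
      omega
    obtain ⟨J, hJ, hJr⟩ := exists_instance_append (n := n) (T := T) (by linarith) (Or.inr hI)
      (by rw [hB]; simp; omega) (f := f) (by
        intro a ha
        rw [hB, List.mem_append, List.mem_singleton] at ha
        rcases ha with ha | rfl
        · have := hprev a ha
          change a.release + T ≤ r
          linarith
        · exact hr1)
    have hagree : (A.run I).AgreeUpTo (A.run J) r := A.agreeUpTo_run hJr
    have hJr' : J.requests = B ++ C ++ [g] ++ [f] := by rw [hJr, hB]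
    have hCJ : ∀ a ∈ C, ¬ (A.run J).Serves a := by
      intro a ha hs
      have := hprev a (List.mem_append_right _ ha)
      exact hC a ha (hagree.symm.serves (by linarith) hs)
    -- the shuttle moves on to the new request
    obtain ⟨o', hoa, ho'⟩ := o.exists_goto (r := s) (by linarith) hm
    have hos' : o'.pos (s + 2) = f.loc := by
      refine ho' _ ?_
      rw [hos, sub_neg_eq_add, ← two_mul, abs_mul, hloc]
      norm_num
    have hoC'' : ∀ a ∈ C, ∃ t ∈ Set.Icc a.release (a.release + 2), t ≤ s + 2 ∧
        o'.pos t = a.loc := by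
      intro a ha
      obtain ⟨t, ht, hts, hx⟩ := hoC a ha
      exact ⟨t, ht, by linarith, by rw [← hoa t ⟨a.release_nonneg.trans ht.1, hts⟩, hx]⟩
    have hD2 : D ≤ 2 := by
      refine hdist.trans (abs_le.2 ?_)
      have h1 := (A.run I).pos_mem _ hr0
      exact ⟨by linarith [h1.1, g.loc_mem.2], by linarith [h1.2, g.loc_mem.1]⟩
    have hjn : 2 * η * (j + 1) ≤ 1 := by
      refine le_trans (mul_le_mul_of_nonneg_left ?_ (by linarith)) hηn
      have : j + 1 ≤ n := by omega
      exact_mod_cast this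
    have hjη : 0 ≤ 2 * η * j := by positivity
    have hgo : o'.Serves g := by
      refine ⟨s, ⟨hgs, by linarith⟩, ?_⟩
      rw [← hoa s ⟨by linarith, le_rfl⟩, hos]
    have hfo : o'.Serves f :=
      ⟨s + 2, ⟨by change r ≤ s + 2; linarith, by change s + 2 ≤ r + 2; linarith⟩, hos'⟩
    have hgJ : ¬ (A.run J).Serves g := by
      rintro hg
      obtain ⟨t, ht, hx⟩ := id hg
      have htr : r < t := by
        by_contra hle
        rw [not_lt] at hle
        refine hr6 t ⟨ht.1, hle⟩ ?_
        rw [hagree t ⟨by linarith [ht.1], hle⟩, hx]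
      have hfJ : ¬ (A.run J).Serves f := by
        rintro ⟨t', ht', hx'⟩
        have ht1 : r ≤ t' := ht'.1
        have ht2 : t' ≤ r + 2 := ht'.2
        have := (A.run J).speed_le t t' (by linarith) (by linarith)
        rw [hx, hx'] at this
        change |g.loc - -g.loc| ≤ _ at this
        rw [sub_neg_eq_add, ← two_mul, abs_mul, hloc, abs_of_pos (by norm_num : (0 : ℝ) < 2)]
          at this
        have h1 := ht.2
        rcases le_abs.1 this with h2 | h2 <;> linarith
      have h1 := h J hJ o'
      rw [hJr'] at h1
      simp only [Itinerary.servedSum_append] at h1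
      rw [Itinerary.servedSum_singleton hgo, Itinerary.servedSum_singleton hfo,
        Itinerary.servedSum_singleton hg, Itinerary.servedSum_singleton_of_not hfJ,
        Itinerary.servedSum_eq_zero hCJ, Itinerary.servedSum_eq_weightSum (p := o') (L := C)
          (fun a ha => (hoC'' a ha).imp fun t ht => ⟨ht.1, ht.2.2⟩), hCsum, hw] at h1
      have h2 := (A.run J).servedSum_le_weightSum B
      have h3 := mul_nonneg hc.le (o'.servedSum_nonneg B)
      have h4 := hd j (by omega)
      rw [List.sum_take_succ _ _ hj, List.sum_take_succ _ _ (by omega)] at h4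
      change c * (_ + _ + _ + d[j + 1]) < _ at h1
      rw [hBsum] at h2
      linarith
    refine ⟨J, hJ, B, C ++ [g], f, o', 2 - η, s + 2, by rw [hJr']; simp, hmapB, ?_, rfl,
      by simpa [f] using hloc, by linarith, ?_, ?_, ?_, hfo, hos', ?_, ?_⟩
    · rw [List.map_append, hmapC, List.map_singleton, hw, List.take_append_getElem]
    · change _ ≤ |(A.run J).pos r - -g.loc|
      rw [← hagree r ⟨by linarith, le_rfl⟩, sub_neg_eq_add]
      exact hr4
    · intro a ha
      rcases List.mem_append.1 ha with ha | ha
      · exact hCJ a ha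
      · obtain rfl := List.mem_singleton.1 ha
        exact hgJ
    · intro a ha
      rcases List.mem_append.1 ha with ha | ha
      · exact hoC'' a ha
      · obtain rfl := List.mem_singleton.1 ha
        exact ⟨s, ⟨hgs, by linarith⟩, by linarith,
          by rw [← hoa s ⟨by linarith, le_rfl⟩, hos]⟩
    · change r ≤ s + 2
      linarith
    · change s + 2 - r + 1 ≤ _
      push_cast
      linarith

/-- After the two phases the algorithm serves at most the last request and the negligible weight of
the first `q` requests, while the shuttle serves all other requests. -/
theorem OnlineAlgorithm.not_beats (A : OnlineAlgorithm) {n q : ℕ} {T c : ℝ} (hT : 1 ≤ T)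
    (hT2 : T < 2) (hq : 1 ≤ q) (hqn : q < n) (hqT : 1 < (q + 1) * (2 - T))
    (hc : alpha (n - q) < c) : ¬ A.Beats n T c := by
  intro h
  have hc0 : 0 < c := (alpha_nonneg _).trans_lt hc
  obtain ⟨d, hdl, hdpos, hdr⟩ := exists_ratiosBelow_of_alpha_lt hc
  have hd0 : 0 < d.length := by omega
  obtain ⟨b, hbl, hbpos, hv, hd⟩ := exists_small_weights hc0 (hdpos _ (List.getElem_mem hd0)) hdr q
  have hn0 : (0 : ℝ) < n := by
    have : 0 < n := by omega
    exact_mod_cast this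
  obtain ⟨η, hη, hηmin⟩ := exists_between
    (lt_min (by linarith : 0 < 2 - T) (by positivity : 0 < 1 / (2 * (n : ℝ))))
  obtain ⟨hηT, hηn⟩ := lt_min_iff.1 hηmin
  rw [lt_div_iff₀ (by positivity)] at hηn
  have hlast := hv q (by simp [hbl])
  have hget : (b ++ [d[0]])[q]'(by simp [hbl]) = d[0] := by
    subst hbl
    simp
  have htake : (b ++ [d[0]]).take q = b := by rw [← hbl, List.take_left]
  have h0 := h.first_phase hc0 hT hT2 hη (v := b ++ [d[0]])
    (by simp; omega)
    (by
      intro x hx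
      rcases List.mem_append.1 hx with hx | hx
      · exact hbpos x hx
      · rw [List.mem_singleton.1 hx]
        exact hdpos _ (List.getElem_mem hd0))
    hv q (by simp [hbl])
  rw [hget, htake] at h0 hlast
  obtain ⟨I, hI, B, C, g, o, D, s, hB, hmapB, hmapC, hw, -, -, -, hC, hoC, hog, -⟩ :=
    h.second_phase hc0 hT hT2 hη hηT (by linarith) (b := b) (by omega) hdpos hd0 hlast hd
      (by
        obtain ⟨I, hI, B, g, hB, hmap, hw, hloc, hrel, hdist⟩ := h0
        refine ⟨I, hI, B, g, hB, hmap, hw, hloc, hrel hq, lt_of_lt_of_le (lt_min ?_ ?_) hdist⟩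
        · linarith
        · linarith)
      (d.length - 1) (by omega)
  have h1 := h I hI o
  rw [hB] at h1
  simp only [Itinerary.servedSum_append] at h1
  rw [Itinerary.servedSum_singleton hog, Itinerary.servedSum_eq_zero hC,
    Itinerary.servedSum_eq_weightSum (p := o) (L := C)
      (fun a ha => (hoC a ha).imp fun t ht => ⟨ht.1, ht.2.2⟩)] at h1
  have h2 := (A.run I).servedSum_le_weightSum B
  have h3 := mul_nonneg hc0.le (o.servedSum_nonneg B)
  have h4 := (A.run I).servedSum_le_weightSum [g]
  rw [weightSum_singleton, hw] at h4
  have h5 := hd (d.length - 1) (by omega)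
  have h6 := List.sum_take_succ d (d.length - 1) (by omega)
  rw [List.take_of_length_le (by omega : d.length ≤ d.length - 1 + 1)] at h6
  rw [List.take_of_length_le (by omega : d.length ≤ d.length - 1 + 2), h6] at h5
  have h7 : weightSum C = (d.take (d.length - 1)).sum := by rw [weightSum, hmapC]
  have h8 : weightSum B = b.sum := by rw [weightSum, hmapB]
  rw [h7, hw] at h1
  rw [h8] at h2
  linarith

/-! ### The optimal values -/

theorem OnlineAlgorithm.bddBelow_performance (A : OnlineAlgorithm) (n : ℕ) (T : ℝ) :
    BddBelow (Set.range fun I : instanceClass n T => (A.run I).performance I) :=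
  ⟨0, by rintro _ ⟨I, rfl⟩; exact (A.run I).performance_nonneg I⟩

theorem OnlineAlgorithm.bddBelow_ratio (A : OnlineAlgorithm) (n : ℕ) (T : ℝ) :
    BddBelow (Set.range fun I : instanceClass n T =>
      (A.run I).performance I / optPerformance I) :=
  ⟨0, by
    rintro _ ⟨I, rfl⟩
    exact div_nonneg ((A.run I).performance_nonneg I) (optPerformance_pos I.2.1).le⟩

theorem nonempty_instanceClass {n : ℕ} (hn : 1 ≤ n) (T : ℝ) : Nonempty (instanceClass n T) := by
  let f : Request := ⟨0, 0, 1, by norm_num, le_rfl, one_pos⟩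
  exact ⟨⟨[f], List.pairwise_singleton _ _⟩, by simp, by simpa using hn,
    List.pairwise_singleton _ _⟩

instance : Nonempty OnlineAlgorithm := ⟨⟨fun _ => Itinerary.stay, fun _ _ _ _ _ _ _ => rfl⟩⟩

theorem OnlineAlgorithm.classPerformance_le_competitiveRatio (A : OnlineAlgorithm) {n : ℕ}
    (hn : 1 ≤ n) (T : ℝ) : A.classPerformance n T ≤ A.competitiveRatio n T := by
  have := nonempty_instanceClass hn T
  refine le_ciInf fun I => (ciInf_le (A.bddBelow_performance n T) I).trans ?_
  exact le_div_self ((A.run I).performance_nonneg I) (optPerformance_pos I.2.1)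
    (optPerformance_le_one I)

theorem OnlineAlgorithm.competitiveRatio_le_one (A : OnlineAlgorithm) {n : ℕ}
    (hn : 1 ≤ n) (T : ℝ) : A.competitiveRatio n T ≤ 1 := by
  obtain ⟨I⟩ := nonempty_instanceClass hn T
  exact (ciInf_le (A.bddBelow_ratio n T) I).trans
    (div_le_one_of_le₀ (performance_le_optPerformance _ _) (optPerformance_pos I.2.1).le)

theorem optimalPerformance_le_optimalCompetitiveRatio {n : ℕ} (hn : 1 ≤ n) (T : ℝ) :
    optimalPerformance n T ≤ optimalCompetitiveRatio n T :=
  ciSup_mono ⟨1, by rintro _ ⟨A, rfl⟩; exact A.competitiveRatio_le_one hn T⟩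
    fun A => A.classPerformance_le_competitiveRatio hn T

theorem optimalCompetitiveRatio_le_one {n : ℕ} (hn : 1 ≤ n) (T : ℝ) :
    optimalCompetitiveRatio n T ≤ 1 :=
  ciSup_le fun A => A.competitiveRatio_le_one hn T

theorem alpha_le_optimalPerformance {n q : ℕ} {u T : ℝ} (hu : 0 ≤ u) (hu1 : u ≤ 1)
    (huT : 2 - u ≤ T) (hqu : q * u ≤ 1) (hqn : q < n) :
    alpha (n - q) ≤ optimalPerformance n T := by
  obtain ⟨A, hA⟩ := exists_onlineAlgorithm_alpha_le hu hu1 hqu hqn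
  have hn : 1 ≤ n := by omega
  have := nonempty_instanceClass hn T
  refine le_trans ?_ (le_ciSup (f := fun A : OnlineAlgorithm => A.classPerformance n T) ?_ A)
  · exact le_ciInf fun I => hA I I.2.1 (Spaced.mono I.2.2.2 huT) I.2.2.1
  · refine ⟨1, ?_⟩
    rintro _ ⟨A, rfl⟩
    exact (A.classPerformance_le_competitiveRatio hn T).trans (A.competitiveRatio_le_one hn T)

theorem optimalCompetitiveRatio_le_alpha {n q : ℕ} {T : ℝ} (hT : 1 ≤ T) (hT2 : T < 2)
    (hq : 1 ≤ q) (hqn : q < n) (hqT : 1 < (q + 1) * (2 - T)) :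
    optimalCompetitiveRatio n T ≤ alpha (n - q) := by
  refine ciSup_le fun A => le_of_forall_gt_imp_ge_of_dense fun c hc => ?_
  by_contra hlt
  rw [not_le] at hlt
  refine A.not_beats hT hT2 hq hqn hqT hc fun I hI o => ?_
  have h1 := hlt.trans_le (ciInf_le (A.bddBelow_ratio n T) ⟨I, hI⟩)
  rw [lt_div_iff₀ (optPerformance_pos hI.1)] at h1
  have hc0 : 0 ≤ c := (alpha_nonneg _).trans hc.le
  have h2 := (mul_le_mul_of_nonneg_left (performance_le_optPerformance o I) hc0).trans_lt h1
  rwa [Itinerary.performance_eq, Itinerary.performance_eq, ← mul_div_assoc,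
    div_lt_div_iff_of_pos_right (weightSum_pos hI.1)] at h2

end OPTiWinD

theorem mainTheorem1 (n : ℕ) (hn : 2 ≤ n) (T : ℝ) :
    (1 ≤ T → T ≤ 2 - 1 / ((n : ℝ) - 1) →
      OPTiWinD.optimalPerformance n T = OPTiWinD.alpha (n - ⌊1 / (2 - T)⌋₊) ∧
      OPTiWinD.optimalCompetitiveRatio n T = OPTiWinD.alpha (n - ⌊1 / (2 - T)⌋₊)) ∧
    (2 - 1 / ((n : ℝ) - 1) ≤ T →
      OPTiWinD.optimalPerformance n T = 1 ∧
      OPTiWinD.optimalCompetitiveRatio n T = 1) := by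
  have hn1 : (1 : ℝ) ≤ (n : ℝ) - 1 := by
    have : (2 : ℝ) ≤ n := by exact_mod_cast hn
    linarith
  have hmid := OPTiWinD.optimalPerformance_le_optimalCompetitiveRatio (by omega : 1 ≤ n) T
  refine ⟨fun hT hTn => ?_, fun hT => ?_⟩
  · have hu : 1 / ((n : ℝ) - 1) ≤ 2 - T := by linarith
    have hu0 : 0 < 2 - T := lt_of_lt_of_le (by positivity) hu
    have hqn : ⌊1 / (2 - T)⌋₊ < n := by
      rw [Nat.floor_lt (by positivity), div_lt_iff₀ hu0]
      rw [div_le_iff₀ (by linarith)] at hu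
      linarith
    have hq : 1 ≤ ⌊1 / (2 - T)⌋₊ := by
      rw [Nat.one_le_floor_iff, le_div_iff₀ hu0]
      linarith
    have hqu : (⌊1 / (2 - T)⌋₊ : ℝ) * (2 - T) ≤ 1 :=
      (le_div_iff₀ hu0).1 (Nat.floor_le (by positivity))
    have hqT : 1 < ((⌊1 / (2 - T)⌋₊ : ℝ) + 1) * (2 - T) :=
      (div_lt_iff₀ hu0).1 (Nat.lt_floor_add_one _)
    have hlow := OPTiWinD.alpha_le_optimalPerformance (T := T) hu0.le (by linarith) (by linarith)
      hqu hqn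
    have hup := OPTiWinD.optimalCompetitiveRatio_le_alpha hT (by linarith) hq hqn hqT
    exact ⟨le_antisymm (hmid.trans hup) hlow, le_antisymm hup (hlow.trans hmid)⟩
  · have hcast : ((n - 1 : ℕ) : ℝ) = (n : ℝ) - 1 := by
      rw [Nat.cast_sub (by omega), Nat.cast_one]
    have hlow := OPTiWinD.alpha_le_optimalPerformance (n := n) (q := n - 1) (T := T)
      (u := 1 / ((n : ℝ) - 1)) (by positivity) (div_le_one_of_le₀ hn1 (by linarith)) hT
      (by rw [hcast, mul_one_div_cancel (by linarith)]) (by omega)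
    rw [show n - (n - 1) = 1 by omega, OPTiWinD.alpha_one] at hlow
    have hup := OPTiWinD.optimalCompetitiveRatio_le_one (by omega : 1 ≤ n) T
    exact ⟨le_antisymm (hmid.trans hup) hlow, le_antisymm hup (hlow.trans hmid)⟩
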